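/- Let $\mathfrak g_2\subset\mathfrak{so}(7)$ be the Lie algebra of real $7\times7$ matrices which, in the basis $e_1,\ F_k=\tfrac12(e_{2k}-ie_{2k+1}),\ \bar F_k$ $(k=1,2,3)$ of $\mathbb C^7$, have the form $$\begin{pmatrix}0&-ia^*&ia^t\\-2ia&D&[\bar a]\\2i\bar a&[a]&\bar D\end{pmatrix},\qquad a\in\mathbb C^3,\ D\in\mathfrak{su}(3),\qquad [a]=\begin{pmatrix}0&a_3&-a_2\\-a_3&0&a_1\\a_2&-a_1&0\end{pmatrix},$$ let $G_2\subset SO(7)$ be the connected Lie subgroup with Lie algebra $\mathfrak g_2$, and let $x\colon G_2\to S^6$, $x(g)=g e_1$. Let $\theta\in\Omega^1(G_2;\mathbb C^3)$ be the component $a$ of the Maurer--Cartan form $g^{-1}dg$. Let $J_{can}$ be the octonionic almost complex structure of $S^6$, i.e. the one whose $(1,0)$-covectors at $x(g)$ are spanned by $\theta^1_g,\theta^2_g,\theta^3_g$ (regarded as covectors on $T_{x(g)}S^6$), and let $\omega(u,v)=g_{can}(J_{can}u,v)$, where $g_{can}$ is the round metric. Let $J$ be a smooth almost complex structure on $S^6$.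 Let $\pi\colon F_J\to S^6$ be the bundle of $J$-frames, whose elements over $y$ are the complex linear isomorphisms $u\colon(T_yS^6,J)\to(\mathbb C^3,i)$, with tautological form $\eta(v)=u(d\pi(v))$, and let $B_J=\{(g,u)\in G_2\times F_J: x(g)=\pi(u)\}$. Pull $\theta$ and $\eta$ back to $B_J$. Then there are unique maps $r,s\colon B_J\to\mathbb C^{3\times3}$ with $\theta=r\eta+s\bar\eta$ on $B_J$. If moreover $J$ is integrable (induced by a complex manifold structure on $S^6$) and $\omega$-compatible ($\omega(u,v)=\omega(Ju,Jv)$ for all $u,v$), then **Chern's identity** holds at every point of $B_J$: $$\det(\bar s)=\det(r).$$ -/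

import Mathlib

open scoped Manifold ContDiff Bundle Matrix

noncomputable section

set_option linter.unusedSimpArgs false
set_option linter.unnecessarySeqFocus false

/-! ### The Lie algebra and the Lie group `G₂` -/

/-- The indexing of a basis `e₁, F₁, F₂, F₃, F̄₁, F̄₂, F̄₃` of `ℂ⁷`. -/
abbrev FrameIdx : Type := Unit ⊕ (Fin 3 ⊕ Fin 3)

/-- The positions of `e₂, e₄, e₆` in `e₁, …, e₇` (which are numbered from `0` in `Fin 7`). -/
def reIdx : Fin 3 → Fin 7 := ![1, 3, 5]

/-- The positions of `e₃, e₅, e₇`. -/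
def imIdx : Fin 3 → Fin 7 := ![2, 4, 6]

/-- The matrix with columns `e₁`, `F_k = (e_{2k} - i e_{2k+1}) / 2` and `F̄_k`. -/
def stdFrame : Matrix (Fin 7) FrameIdx ℂ :=
  Matrix.of fun i b =>
    Sum.elim (fun _ => (Pi.single 0 1 : Fin 7 → ℂ) i)
      (Sum.elim
        (fun k => ((Pi.single (reIdx k) 1 : Fin 7 → ℂ) i
          - Complex.I * (Pi.single (imIdx k) 1 : Fin 7 → ℂ) i) / 2)
        (fun k => ((Pi.single (reIdx k) 1 : Fin 7 → ℂ) i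
          + Complex.I * (Pi.single (imIdx k) 1 : Fin 7 → ℂ) i) / 2)) b

/-- The inverse of `stdFrame`. -/
def stdCoframe : Matrix FrameIdx (Fin 7) ℂ :=
  Matrix.of fun b i =>
    Sum.elim (fun _ => (Pi.single 0 1 : Fin 7 → ℂ) i)
      (Sum.elim
        (fun k => (Pi.single (reIdx k) 1 : Fin 7 → ℂ) i
          + Complex.I * (Pi.single (imIdx k) 1 : Fin 7 → ℂ) i)
        (fun k => (Pi.single (reIdx k) 1 : Fin 7 → ℂ) i
          - Complex.I * (Pi.single (imIdx k) 1 : Fin 7 → ℂ) i)) b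

theorem stdCoframe_mul_apply_zero {n : Type*} (B : Matrix (Fin 7) n ℂ) (j : n) :
    (stdCoframe * B) (Sum.inl ()) j = B 0 j := by
  simp [stdCoframe, Matrix.mul_apply, Pi.single_apply]

theorem stdCoframe_mul_apply_left {n : Type*} (B : Matrix (Fin 7) n ℂ) (k : Fin 3) (j : n) :
    (stdCoframe * B) (Sum.inr (Sum.inl k)) j = B (reIdx k) j + Complex.I * B (imIdx k) j := by
  simp [stdCoframe, Matrix.mul_apply, Pi.single_apply, add_mul, Finset.sum_add_distrib]

theorem stdCoframe_mul_apply_right {n : Type*} (B : Matrix (Fin 7) n ℂ) (k : Fin 3) (j : n) :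
    (stdCoframe * B) (Sum.inr (Sum.inr k)) j = B (reIdx k) j - Complex.I * B (imIdx k) j := by
  simp [stdCoframe, Matrix.mul_apply, Pi.single_apply, sub_mul, Finset.sum_sub_distrib]

theorem reIdx_ne_zero (k : Fin 3) : reIdx k ≠ 0 := by fin_cases k <;> decide

theorem imIdx_ne_zero (k : Fin 3) : imIdx k ≠ 0 := by fin_cases k <;> decide

theorem reIdx_ne_imIdx (k l : Fin 3) : reIdx k ≠ imIdx l := by
  fin_cases k <;> fin_cases l <;> decide

theorem reIdx_inj {k l : Fin 3} : reIdx k = reIdx l ↔ k = l := by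
  fin_cases k <;> fin_cases l <;> decide

theorem imIdx_inj {k l : Fin 3} : imIdx k = imIdx l ↔ k = l := by
  fin_cases k <;> fin_cases l <;> decide

theorem stdCoframe_mul_stdFrame : stdCoframe * stdFrame = 1 := by
  ext (i | k | k) (j | l | l)
  case' inl.inl => rw [stdCoframe_mul_apply_zero]
  case' inl.inr.inl => rw [stdCoframe_mul_apply_zero]
  case' inl.inr.inr => rw [stdCoframe_mul_apply_zero]
  case' inr.inl.inl => rw [stdCoframe_mul_apply_left]
  case' inr.inl.inr.inl => rw [stdCoframe_mul_apply_left]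
  case' inr.inl.inr.inr => rw [stdCoframe_mul_apply_left]
  case' inr.inr.inl => rw [stdCoframe_mul_apply_right]
  case' inr.inr.inr.inl => rw [stdCoframe_mul_apply_right]
  case' inr.inr.inr.inr => rw [stdCoframe_mul_apply_right]
  all_goals
    simp [stdFrame, Pi.single_apply, Matrix.one_apply, reIdx_ne_zero, imIdx_ne_zero, reIdx_inj,
      imIdx_inj, reIdx_ne_imIdx, (reIdx_ne_zero _).symm, (imIdx_ne_zero _).symm,
      (reIdx_ne_imIdx _ _).symm]
  all_goals
    by_cases h : k = l <;> simp [h] <;> ring_nf <;> simp <;> ring_nf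

theorem stdFrame_mul_stdCoframe : stdFrame * stdCoframe = 1 :=
  (Matrix.mul_eq_one_comm_of_card_eq FrameIdx (Fin 7) ℂ (by simp)).1 stdCoframe_mul_stdFrame

/-- A real `7 × 7` matrix, written in the basis `e₁, F, F̄` of `ℂ⁷`. -/
def inStdFrame (A : Matrix (Fin 7) (Fin 7) ℝ) : Matrix FrameIdx FrameIdx ℂ :=
  stdCoframe * A.map Complex.ofReal * stdFrame

/-- The skew matrix `[a]`. -/
def skewMat (a : Fin 3 → ℂ) : Matrix (Fin 3) (Fin 3) ℂ :=
  !![0, a 2, -a 1; -a 2, 0, a 0; a 1, -a 0, 0]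

/-- The complex block matrix
`(0, -i a^*, i a^t; -2 i a, D, [ā]; 2 i ā, [a], D̄)`. -/
def g2Block (a : Fin 3 → ℂ) (D : Matrix (Fin 3) (Fin 3) ℂ) : Matrix FrameIdx FrameIdx ℂ :=
  Matrix.fromBlocks 0
    (Matrix.fromCols
      (Matrix.replicateRow Unit (-Complex.I • star a)) (Matrix.replicateRow Unit (Complex.I • a)))
    (Matrix.fromRows
      (Matrix.replicateCol Unit ((-2 * Complex.I) • a))
      (Matrix.replicateCol Unit ((2 * Complex.I) • star a)))
    (Matrix.fromBlocks D (skewMat (star a)) (skewMat a) (D.map star))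

/-- The Lie algebra `𝔤₂`, as a set of real `7 × 7` matrices. -/
def g2LieAlgebra : Set (Matrix (Fin 7) (Fin 7) ℝ) :=
  {A | ∃ (a : Fin 3 → ℂ) (D : Matrix (Fin 3) (Fin 3) ℂ),
    Dᴴ = -D ∧ D.trace = 0 ∧ inStdFrame A = g2Block a D}

/-- The group `G₂ ⊂ SO(7)`: the connected Lie subgroup with Lie algebra `𝔤₂`, i.e. the subgroup
generated by the exponentials of elements of `𝔤₂`. -/
def G2 : Subgroup (Matrix.specialOrthogonalGroup (Fin 7) ℝ) :=
  Subgroup.closure {g | ∃ A ∈ g2LieAlgebra, (g : Matrix (Fin 7) (Fin 7) ℝ) = NormedSpace.exp A}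

/-- The underlying real matrix of an element of `G₂`. -/
def G2.mat (g : G2) : Matrix (Fin 7) (Fin 7) ℝ := (g : Matrix.specialOrthogonalGroup (Fin 7) ℝ)

/-- The Maurer–Cartan form `φ = g⁻¹ dg` on a tangent vector `X ∈ T_g G₂` (a real `7 × 7` matrix),
written in the basis `e₁, F, F̄`. -/
def maurerCartan (g : G2) (X : Matrix (Fin 7) (Fin 7) ℝ) : Matrix FrameIdx FrameIdx ℂ :=
  inStdFrame (G2.mat g⁻¹ * X)

/-- The `ℂ³`-valued form `θ` on `G₂`: the block of `φ` in the rows `F` and the column `e₁` is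
`-2 i θ`. -/
def theta (g : G2) (X : Matrix (Fin 7) (Fin 7) ℝ) : Fin 3 → ℂ :=
  fun k => Complex.I / 2 * maurerCartan g X (Sum.inr (Sum.inl k)) (Sum.inl ())

/-! ### The six-sphere and its standard two-form -/

/-- `ℝ⁷` with the standard inner product. -/
abbrev E7 : Type := EuclideanSpace ℝ (Fin 7)

/-- The unit sphere `S⁶ ⊂ ℝ⁷`, with the smooth structure that Mathlib gives it. -/
abbrev S6 : Type := Metric.sphere (0 : E7) 1

/-- The model vector space of `S⁶`. -/
abbrev E6 : Type := EuclideanSpace ℝ (Fin 6)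

/-- The tangent space `T_y S⁶`. -/
abbrev TS6 (y : S6) : Type := TangentSpace (𝓡 6) y

/-- The inclusion `T_y S⁶ → ℝ⁷`, i.e. the differential of `S⁶ ⊂ ℝ⁷`. -/
def tangentIncl (y : S6) : TS6 y →L[ℝ] E7 :=
  mfderiv (𝓡 6) 𝓘(ℝ, E7) (fun z : S6 => (z : E7)) y

theorem G2.transpose_mul (g : G2) : (G2.mat g)ᵀ * G2.mat g = 1 :=
  (Matrix.mem_orthogonalGroup_iff' _ _).1
    (Matrix.mem_specialOrthogonalGroup_iff.1 (g : Matrix.specialOrthogonalGroup (Fin 7) ℝ).2).1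

/-- The orbit map `x : G₂ → S⁶`, `x(g) = g e₁`. -/
def orbit (g : G2) : S6 :=
  ⟨WithLp.toLp 2 (G2.mat g *ᵥ Pi.single 0 1), by
    have h := congrFun (congrFun (G2.transpose_mul g) 0) 0
    rw [Matrix.mul_apply] at h
    rw [mem_sphere_zero_iff_norm, EuclideanSpace.norm_eq, Real.sqrt_eq_one]
    simpa [sq] using h⟩

/-- The octonionic cross product on `ℝ⁷ = Im 𝕆`, with structure constants
`e¹²³ + e¹⁴⁵ + e¹⁶⁷ + e²⁴⁶ - e²⁵⁷ - e³⁴⁷ - e³⁵⁶`. -/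
def cross (u v : Fin 7 → ℝ) : Fin 7 → ℝ :=
  ![(u 1 * v 2 - u 2 * v 1) + (u 3 * v 4 - u 4 * v 3) + (u 5 * v 6 - u 6 * v 5),
    (u 2 * v 0 - u 0 * v 2) + (u 3 * v 5 - u 5 * v 3) - (u 4 * v 6 - u 6 * v 4),
    (u 0 * v 1 - u 1 * v 0) - (u 3 * v 6 - u 6 * v 3) - (u 4 * v 5 - u 5 * v 4),
    (u 4 * v 0 - u 0 * v 4) + (u 5 * v 1 - u 1 * v 5) - (u 6 * v 2 - u 2 * v 6),
    (u 0 * v 3 - u 3 * v 0) - (u 6 * v 1 - u 1 * v 6) - (u 5 * v 2 - u 2 * v 5),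
    (u 6 * v 0 - u 0 * v 6) + (u 1 * v 3 - u 3 * v 1) - (u 2 * v 4 - u 4 * v 2),
    (u 0 * v 5 - u 5 * v 0) - (u 1 * v 4 - u 4 * v 1) - (u 2 * v 3 - u 3 * v 2)]

/-- The octonionic almost complex structure `J_can` at `y ∈ S⁶`, acting on vectors `w ∈ ℝ⁷` that
are tangent to the sphere: `J_can w = y × w`. By `theta_octonionicJ` below it is the almost complex
structure for which, for each `g ∈ G₂` with `x(g) = y`, the forms `θ¹_g, θ²_g, θ³_g` span the
`(1,0)`-covectors at `y`. -/
def octonionicJ (y : S6) (w : E7) : E7 :=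
  WithLp.toLp 2 (cross (WithLp.ofLp (y : E7)) (WithLp.ofLp w))

/-- Elements of `𝔤₂` are derivations of the cross product. -/
theorem mulVec_cross_of_mem {A : Matrix (Fin 7) (Fin 7) ℝ} (hA : A ∈ g2LieAlgebra)
    (u v : Fin 7 → ℝ) : A *ᵥ cross u v = cross (A *ᵥ u) v + cross u (A *ᵥ v) := by
  obtain ⟨a, D, hD, htr, h⟩ := hA
  have hAC : stdCoframe * A.map Complex.ofReal = g2Block a D * stdCoframe := by
    rw [← h, inStdFrame, Matrix.mul_assoc, stdFrame_mul_stdCoframe, Matrix.mul_one]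
  have hl : ∀ k j, (A (reIdx k) j : ℂ) + Complex.I * A (imIdx k) j =
      (g2Block a D * stdCoframe) (Sum.inr (Sum.inl k)) j := fun k j => by
    rw [← hAC, stdCoframe_mul_apply_left]; rfl
  have h0 : ∀ j, (A 0 j : ℂ) = (g2Block a D * stdCoframe) (Sum.inl ()) j := fun j => by
    rw [← hAC, stdCoframe_mul_apply_zero]; rfl
  have c00 : A 0 0 = 0 := by
    have := congrArg Complex.re (h0 0)
    simpa [Matrix.mul_apply, g2Block, stdCoframe, (reIdx_ne_zero _).symm, (imIdx_ne_zero _).symm]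
      using this
  have c0 : ∀ k, A (reIdx k) 0 = 2 * (a k).im ∧ A (imIdx k) 0 = -2 * (a k).re := fun k => by
    have := hl k 0
    simpa [Matrix.mul_apply, g2Block, stdCoframe, (reIdx_ne_zero _).symm, (imIdx_ne_zero _).symm,
      Complex.ext_iff, Pi.single_apply] using this
  have r0 : ∀ l, A 0 (reIdx l) = -2 * (a l).im ∧ A 0 (imIdx l) = 2 * (a l).re := fun l => by
    have h1 := congrArg Complex.re (h0 (reIdx l))
    have h2 := congrArg Complex.re (h0 (imIdx l))
    simp [Matrix.mul_apply, g2Block, stdCoframe, reIdx_ne_zero, imIdx_ne_zero, reIdx_inj,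
      imIdx_inj, reIdx_ne_imIdx, (reIdx_ne_imIdx _ _).symm, Pi.single_apply] at h1 h2
    constructor <;> linarith
  have m1 : ∀ k l, A (reIdx k) (reIdx l) = (D k l + skewMat (star a) k l).re ∧
      A (imIdx k) (reIdx l) = (D k l + skewMat (star a) k l).im := fun k l => by
    have h1 := hl k (reIdx l)
    simpa [Matrix.mul_apply, g2Block, stdCoframe, reIdx_ne_zero, imIdx_ne_zero, reIdx_inj,
      imIdx_inj, reIdx_ne_imIdx, (reIdx_ne_imIdx _ _).symm, Pi.single_apply,
      Complex.ext_iff] using h1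
  have m2 : ∀ k l, A (reIdx k) (imIdx l) = -(D k l - skewMat (star a) k l).im ∧
      A (imIdx k) (imIdx l) = (D k l - skewMat (star a) k l).re := fun k l => by
    have h1 := hl k (imIdx l)
    simp [Matrix.mul_apply, g2Block, stdCoframe, reIdx_ne_zero, imIdx_ne_zero, reIdx_inj,
      imIdx_inj, reIdx_ne_imIdx, (reIdx_ne_imIdx _ _).symm, Pi.single_apply,
      Complex.ext_iff] at h1
    constructor
    · rw [h1.1]; simp; ring
    · rw [h1.2]; simp; ring
  have hre : ∀ k l, (D k l).re = -(D l k).re := fun k l => by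
    have := congrArg Complex.re (congrFun (congrFun hD l) k)
    simp at this; linarith
  have him : ∀ k l, (D k l).im = (D l k).im := fun k l => by
    have := congrArg Complex.im (congrFun (congrFun hD l) k)
    simp at this; linarith
  have d22 : (D 2 2).im = -(D 0 0).im - (D 1 1).im := by
    have := congrArg Complex.im htr
    simp [Matrix.trace, Fin.sum_univ_succ] at this; linarith
  have e00 : (D 0 0).re = 0 := by linarith [hre 0 0]
  have e11 : (D 1 1).re = 0 := by linarith [hre 1 1]
  have e22 : (D 2 2).re = 0 := by linarith [hre 2 2]
  simp only [Fin.forall_fin_succ, Fin.forall_fin_zero] at c0 r0 m1 m2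
  simp [reIdx, imIdx, skewMat] at c0 r0 m1 m2
  obtain ⟨⟨x1, x2⟩, ⟨x3, x4⟩, ⟨x5, x6⟩⟩ := c0
  obtain ⟨⟨y1, y2⟩, ⟨y3, y4⟩, ⟨y5, y6⟩⟩ := r0
  ext i
  fin_cases i <;>
    simp [cross, Matrix.mulVec, dotProduct, Fin.sum_univ_succ] <;>
    simp only [c00, x1, x2, x3, x4, x5, x6, y1, y2, y3, y4, y5, y6, m1, m2, hre 1 0, hre 2 0,
      hre 2 1, him 1 0, him 2 0, him 2 1, d22, e00, e11, e22] <;>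
    ring

/-- The cross product as a continuous bilinear map. -/
def crossBilin : (Fin 7 → ℝ) →L[ℝ] (Fin 7 → ℝ) →L[ℝ] (Fin 7 → ℝ) :=
  LinearMap.toContinuousBilinearMap <| LinearMap.mk₂ ℝ cross
    (fun u u' v => by ext i; fin_cases i <;> simp [cross] <;> ring)
    (fun c u v => by ext i; fin_cases i <;> simp [cross] <;> ring)
    (fun u v v' => by ext i; fin_cases i <;> simp [cross] <;> ring)
    (fun c u v => by ext i; fin_cases i <;> simp [cross] <;> ring)

section

attribute [local instance] Matrix.linftyOpNormedRing Matrix.linftyOpNormedAlgebra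

theorem exp_mulVec_cross {A : Matrix (Fin 7) (Fin 7) ℝ} (hA : A ∈ g2LieAlgebra)
    (u v : Fin 7 → ℝ) :
    NormedSpace.exp A *ᵥ cross u v =
      cross (NormedSpace.exp A *ᵥ u) (NormedSpace.exp A *ᵥ v) := by
  let B : Matrix (Fin 7) (Fin 7) ℝ →L[ℝ] (Fin 7 → ℝ) →L[ℝ] (Fin 7 → ℝ) :=
    LinearMap.toContinuousBilinearMap (Matrix.mulVecBilin ℝ ℝ)
  have hB : ∀ M w, B M w = M *ᵥ w := fun _ _ => rfl
  have hC : ∀ u v, crossBilin u v = cross u v := fun _ _ => rfl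
  have hE : ∀ t : ℝ, HasDerivAt (fun s : ℝ => NormedSpace.exp (s • A))
      (A * NormedSpace.exp (t • A)) t := fun t => hasDerivAt_exp_smul_const' A t
  have hN : ∀ t : ℝ, HasDerivAt (fun s : ℝ => NormedSpace.exp (s • -A))
      (NormedSpace.exp (t • -A) * -A) t := fun t => hasDerivAt_exp_smul_const (-A) t
  have hp : ∀ (w : Fin 7 → ℝ) (t : ℝ), HasDerivAt (fun s : ℝ => B (NormedSpace.exp (s • A)) w)
      (A *ᵥ B (NormedSpace.exp (t • A)) w) t := fun w t => by
    have := (B.flip w).hasFDerivAt.comp_hasDerivAt t (hE t)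
    have h2 : (B.flip w) (A * NormedSpace.exp (t • A)) = A *ᵥ B (NormedSpace.exp (t • A)) w := by
      change (A * NormedSpace.exp (t • A)) *ᵥ w = A *ᵥ (NormedSpace.exp (t • A) *ᵥ w)
      rw [Matrix.mulVec_mulVec]
    rw [h2] at this
    exact this
  let F : ℝ → Fin 7 → ℝ := fun s => B (NormedSpace.exp (s • -A))
    (crossBilin (B (NormedSpace.exp (s • A)) u) (B (NormedSpace.exp (s • A)) v))
  have hF : ∀ t, HasDerivAt F 0 t := fun t => by
    have h1 := crossBilin.hasDerivAt_of_bilinear (fun _ => hp u t) (fun _ => hp v t)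
    have h2 := B.hasDerivAt_of_bilinear (fun _ => hN t) (fun _ => h1)
    convert! h2 using 1
    rw [hC, hC, hC, hB, hB, add_comm (cross _ _), ← mulVec_cross_of_mem hA]
    change 0 = NormedSpace.exp (t • -A) *ᵥ (A *ᵥ _) + (NormedSpace.exp (t • -A) * -A) *ᵥ _
    rw [Matrix.mul_neg, Matrix.neg_mulVec, Matrix.mulVec_mulVec, add_neg_cancel]
  have hconst : F 1 = F 0 :=
    is_const_of_deriv_eq_zero (fun t => (hF t).differentiableAt) (fun t => (hF t).deriv) 1 0
  have h10 : NormedSpace.exp (-A) *ᵥ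
      cross (NormedSpace.exp A *ᵥ u) (NormedSpace.exp A *ᵥ v) = cross u v := by
    simpa [F, hB, hC] using hconst
  have hinv : NormedSpace.exp A * NormedSpace.exp (-A) = 1 := by
    rw [← Matrix.exp_add_of_commute _ _ (Commute.neg_right (Commute.refl A))]
    simp
  rw [← h10, Matrix.mulVec_mulVec, hinv, Matrix.one_mulVec]

end

/-- Elements of `G₂` preserve the cross product. -/
theorem G2.mulVec_cross (g : G2) (u v : Fin 7 → ℝ) :
    G2.mat g *ᵥ cross u v = cross (G2.mat g *ᵥ u) (G2.mat g *ᵥ v) := by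
  obtain ⟨g, hg⟩ := g
  change (g : Matrix (Fin 7) (Fin 7) ℝ) *ᵥ cross u v =
    cross ((g : Matrix (Fin 7) (Fin 7) ℝ) *ᵥ u) ((g : Matrix (Fin 7) (Fin 7) ℝ) *ᵥ v)
  have hinv : ∀ h : Matrix.specialOrthogonalGroup (Fin 7) ℝ,
      (h : Matrix (Fin 7) (Fin 7) ℝ) * ((h⁻¹ : Matrix.specialOrthogonalGroup (Fin 7) ℝ) :
        Matrix (Fin 7) (Fin 7) ℝ) = 1 := fun h => by
    rw [← Submonoid.coe_mul, mul_inv_cancel, Submonoid.coe_one]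
  have hinv' : ∀ h : Matrix.specialOrthogonalGroup (Fin 7) ℝ,
      ((h⁻¹ : Matrix.specialOrthogonalGroup (Fin 7) ℝ) : Matrix (Fin 7) (Fin 7) ℝ) *
        (h : Matrix (Fin 7) (Fin 7) ℝ) = 1 := fun h => by
    rw [← Submonoid.coe_mul, inv_mul_cancel, Submonoid.coe_one]
  induction hg using Subgroup.closure_induction generalizing u v with
  | mem h hh =>
    obtain ⟨A, hA, hh⟩ := hh
    rw [hh]
    exact exp_mulVec_cross hA u v
  | one => simp
  | mul a b _ _ ha hb =>
    simp only [Submonoid.coe_mul, ← Matrix.mulVec_mulVec]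
    rw [hb, ha]
  | inv a _ ha =>
    have h := ha ((a⁻¹ : Matrix.specialOrthogonalGroup (Fin 7) ℝ).1 *ᵥ u)
      ((a⁻¹ : Matrix.specialOrthogonalGroup (Fin 7) ℝ).1 *ᵥ v)
    simp only [Matrix.mulVec_mulVec, hinv, Matrix.one_mulVec] at h
    rw [← h, Matrix.mulVec_mulVec, hinv', Matrix.one_mulVec]

/-- `θ_g ∘ J_can = i θ_g`: if `X, X' ∈ T_g G₂` have `dx(X') = J_can dx(X)`, then
`θ(X') = i θ(X)`. Here `dx(X) = X e₁`. -/
theorem theta_octonionicJ (g : G2) (X X' : Matrix (Fin 7) (Fin 7) ℝ)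
    (h : WithLp.toLp 2 (X' *ᵥ Pi.single 0 1) =
      octonionicJ (orbit g) (WithLp.toLp 2 (X *ᵥ Pi.single 0 1))) :
    theta g X' = Complex.I • theta g X := by
  have hinv : G2.mat g⁻¹ * G2.mat g = 1 := by
    have : ((g⁻¹ * g : G2) : Matrix.specialOrthogonalGroup (Fin 7) ℝ).1 = 1 := by
      rw [inv_mul_cancel]; rfl
    exact this
  have hcol : ∀ Y : Matrix (Fin 7) (Fin 7) ℝ, ∀ k, theta g Y k = Complex.I / 2 *
      (((G2.mat g⁻¹ *ᵥ (Y *ᵥ Pi.single 0 1)) (reIdx k) : ℂ) +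
        Complex.I * ((G2.mat g⁻¹ *ᵥ (Y *ᵥ Pi.single 0 1)) (imIdx k) : ℂ)) := fun Y k => by
    rw [theta, maurerCartan, inStdFrame, Matrix.mul_assoc, stdCoframe_mul_apply_left]
    simp [stdFrame, Matrix.mul_apply, Pi.single_apply, Matrix.mulVec, dotProduct]
  have h' : X' *ᵥ Pi.single 0 1 = cross (G2.mat g *ᵥ Pi.single 0 1) (X *ᵥ Pi.single 0 1) :=
    congrArg WithLp.ofLp h
  have h2 : G2.mat g⁻¹ *ᵥ (X' *ᵥ Pi.single 0 1) =
      cross (Pi.single 0 1) (G2.mat g⁻¹ *ᵥ (X *ᵥ Pi.single 0 1)) := by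
    rw [h', G2.mulVec_cross, Matrix.mulVec_mulVec, hinv, Matrix.one_mulVec]
  ext k
  rw [Pi.smul_apply, hcol, hcol, h2, smul_eq_mul]
  fin_cases k <;> simp [cross, reIdx, imIdx] <;> ring_nf <;> simp [Complex.I_sq] <;> ring

/-- The standard two-form `ω(u, v) = g_can(J_can u, v)` on `S⁶`. -/
def omega (y : S6) (u v : TS6 y) : ℝ :=
  inner ℝ (octonionicJ y (tangentIncl y u)) (tangentIncl y v)

/-! ### Almost complex structures, frames, and the fibre product with `G₂` -/

/-- Smooth almost complex structures on `S⁶`. -/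
structure AlmostComplexStructure where
  toFun : ∀ y : S6, TS6 y →L[ℝ] TS6 y
  smooth : ContMDiff (𝓡 6) ((𝓡 6).prod 𝓘(ℝ, E6 →L[ℝ] E6)) ∞
    (fun y => (⟨y, toFun y⟩ : Bundle.TotalSpace (E6 →L[ℝ] E6) (fun y : S6 => TS6 y →L[ℝ] TS6 y)))
  sq_eq_neg : ∀ (y : S6) (v : TS6 y), toFun y (toFun y v) = -v

namespace AlmostComplexStructure

/-- `J` is `ω`-compatible: `ω(u, v) = ω(Ju, Jv)`. -/
def OmegaCompatible (J : AlmostComplexStructure) : Prop :=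
  ∀ (y : S6) (u v : TS6 y), omega y u v = omega y (J.toFun y u) (J.toFun y v)

/-- The differential at `y` of a `ℂ³`-valued map on `S⁶`. -/
def complexDiff (φ : S6 → (Fin 3 → ℂ)) (y : S6) : TS6 y →L[ℝ] (Fin 3 → ℂ) :=
  mfderiv (𝓡 6) 𝓘(ℝ, Fin 3 → ℂ) φ y

/-- `J` is integrable: it is induced by a complex manifold structure, i.e. around each point there
are smooth coordinates with values in `ℂ³` whose differential transports `J` to multiplication
by `i` (so that coordinate changes are holomorphic). -/
def Integrable (J : AlmostComplexStructure) : Prop :=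
  ∀ p : S6, ∃ φ : OpenPartialHomeomorph S6 (Fin 3 → ℂ), p ∈ φ.source ∧
    ContMDiffOn (𝓡 6) 𝓘(ℝ, Fin 3 → ℂ) ∞ φ φ.source ∧
    ContMDiffOn 𝓘(ℝ, Fin 3 → ℂ) (𝓡 6) ∞ φ.symm φ.target ∧
    ∀ y ∈ φ.source, ∀ v : TS6 y,
      complexDiff φ y (J.toFun y v) = Complex.I • complexDiff φ y v

end AlmostComplexStructure

/-- The total space of the smooth vector bundle `Hom_ℝ(TS⁶, ℂ³)` over `S⁶`. -/
abbrev HomBundle : Type :=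
  Bundle.TotalSpace (E6 →L[ℝ] (Fin 3 → ℂ))
    (fun y : S6 => TS6 y →L[ℝ] Bundle.Trivial S6 (Fin 3 → ℂ) y)

/-- The bundle `F_J` of `J`-frames: its elements over `y` are the isomorphisms
`u : T_y S⁶ → ℂ³` that are complex linear with respect to `J` and `i`. -/
def FrameBundle (J : AlmostComplexStructure) : Type :=
  {u : HomBundle // Function.Bijective u.2 ∧
    ∀ v : TS6 u.1, (u.2 (J.toFun u.1 v) : Fin 3 → ℂ) = Complex.I • (u.2 v : Fin 3 → ℂ)}

/-- The fibre product `B_J` of `x : G₂ → S⁶` and `π : F_J → S⁶`. -/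
structure FibreProduct (J : AlmostComplexStructure) where
  g : G2
  u : FrameBundle J
  base_eq : orbit g = u.1.1

/-- A curve in `B_J` is smooth at time `0` if its components in `G₂` (a submanifold of the space of
`7 × 7` matrices) and in `F_J` (a submanifold of `Hom_ℝ(TS⁶, ℂ³)`) are. Each tangent vector of
`B_J` at `γ 0` is the velocity at time `0` of such a curve. -/
def SmoothAtZero {J : AlmostComplexStructure} (γ : ℝ → FibreProduct J) : Prop :=
  (∀ i j, ContDiffAt ℝ ∞ (fun t => G2.mat (γ t).g i j) 0) ∧
    ContMDiffAt 𝓘(ℝ, ℝ) ((𝓡 6).prod 𝓘(ℝ, E6 →L[ℝ] (Fin 3 → ℂ))) ∞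
      (fun t => ((γ t).u.1 : HomBundle)) 0

/-- The pullback of `θ` to `B_J`, evaluated on the velocity of `γ` at time `0`. -/
def thetaVelocity {J : AlmostComplexStructure} (γ : ℝ → FibreProduct J) : Fin 3 → ℂ :=
  theta (γ 0).g (Matrix.of fun i j => deriv (fun t => G2.mat (γ t).g i j) 0)

/-- The pullback to `B_J` of the tautological form `η(v) = u(dπ(v))` of `F_J`, evaluated on the
velocity of `γ` at time `0`. -/
def etaVelocity {J : AlmostComplexStructure} (γ : ℝ → FibreProduct J) : Fin 3 → ℂ :=
  (γ 0).u.1.2 (mfderiv 𝓘(ℝ, ℝ) (𝓡 6) (fun t => (γ t).u.1.1) 0 (1 : ℝ))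

/-- `θ = r η + s η̄` on `B_J`, as an equality of one-forms. -/
def ThetaEqEta (J : AlmostComplexStructure) (r s : FibreProduct J → Matrix (Fin 3) (Fin 3) ℂ) :
    Prop :=
  ∀ γ : ℝ → FibreProduct J, SmoothAtZero γ →
    thetaVelocity γ = r (γ 0) *ᵥ etaVelocity γ + s (γ 0) *ᵥ star (etaVelocity γ)

end

noncomputable section

/-! ### Linear algebra -/

theorem G2.mul_transpose (g : G2) : G2.mat g * (G2.mat g)ᵀ = 1 :=
  mul_eq_one_comm.1 (G2.transpose_mul g)

theorem G2.mat_inv (g : G2) : G2.mat g⁻¹ = (G2.mat g)ᵀ := by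
  have h : G2.mat g⁻¹ * G2.mat g = 1 := by
    have : ((g⁻¹ * g : G2) : Matrix.specialOrthogonalGroup (Fin 7) ℝ).1 = 1 := by
      rw [inv_mul_cancel]; rfl
    exact this
  calc G2.mat g⁻¹ = G2.mat g⁻¹ * (G2.mat g * (G2.mat g)ᵀ) := by
        rw [G2.mul_transpose, Matrix.mul_one]
    _ = (G2.mat g)ᵀ := by rw [← Matrix.mul_assoc, h, Matrix.one_mul]

theorem G2.mat_mul (g h : G2) : G2.mat (g * h) = G2.mat g * G2.mat h := rfl

theorem G2.mat_inv_mulVec_dotProduct (g : G2) (u v : Fin 7 → ℝ) :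
    (G2.mat g⁻¹ *ᵥ u) ⬝ᵥ (G2.mat g⁻¹ *ᵥ v) = u ⬝ᵥ v := by
  rw [Matrix.dotProduct_mulVec, Matrix.vecMul_mulVec, ← Matrix.dotProduct_mulVec,
    ← Matrix.mulVec_mulVec, Matrix.mulVec_mulVec, G2.transpose_mul, Matrix.one_mulVec]

/-- The value of `θ` at the identity, as a function of the image in `ℝ⁷` of a tangent vector. -/
def thetaOne : (Fin 7 → ℝ) →ₗ[ℝ] (Fin 3 → ℂ) where
  toFun w k := Complex.I / 2 * (w (reIdx k) + Complex.I * w (imIdx k))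
  map_add' u v := by ext k; simp; ring
  map_smul' c u := by ext k; simp; ring

theorem thetaOne_apply (w : Fin 7 → ℝ) (k : Fin 3) :
    thetaOne w k = Complex.I / 2 * (w (reIdx k) + Complex.I * w (imIdx k)) := rfl

/-- `θ_g`, as a function of the image in `ℝ⁷` of a tangent vector. -/
def thetaAt (g : G2) : (Fin 7 → ℝ) →ₗ[ℝ] (Fin 3 → ℂ) :=
  thetaOne ∘ₗ Matrix.mulVecLin (G2.mat g⁻¹)

theorem theta_eq_thetaAt (g : G2) (X : Matrix (Fin 7) (Fin 7) ℝ) :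
    theta g X = thetaAt g (X *ᵥ Pi.single 0 1) := by
  ext k
  rw [theta, maurerCartan, inStdFrame, Matrix.mul_assoc, stdCoframe_mul_apply_left]
  simp [thetaAt, thetaOne_apply, stdFrame, Matrix.mul_apply, Pi.single_apply, Matrix.mulVec,
    dotProduct]

/-- On `e₁^⊥ = ℂ³` the octonionic three-form is the imaginary part of a multiple of the complex
volume form. -/
theorem cross_dotProduct_of_apply_zero {u v w : Fin 7 → ℝ} (hu : u 0 = 0) (hv : v 0 = 0)
    (hw : w 0 = 0) :
    cross u v ⬝ᵥ w = -8 * (Matrix.of ![thetaOne u, thetaOne v, thetaOne w]).det.im := by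
  rw [Matrix.det_fin_three]
  simp [thetaOne_apply, reIdx, imIdx, cross, dotProduct, Fin.sum_univ_succ, hu, hv, hw]
  ring

theorem cross_dotProduct (g : G2) {u v w : Fin 7 → ℝ} {a b c : Fin 3 → ℂ}
    (ha : thetaAt g u = a) (hb : thetaAt g v = b) (hc : thetaAt g w = c)
    (hu : (G2.mat g *ᵥ Pi.single 0 1) ⬝ᵥ u = 0) (hv : (G2.mat g *ᵥ Pi.single 0 1) ⬝ᵥ v = 0)
    (hw : (G2.mat g *ᵥ Pi.single 0 1) ⬝ᵥ w = 0) :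
    cross u v ⬝ᵥ w = -8 * (Matrix.of ![a, b, c]).det.im := by
  subst ha hb hc
  have h0 : ∀ x, (G2.mat g *ᵥ Pi.single 0 1) ⬝ᵥ x = 0 → (G2.mat g⁻¹ *ᵥ x) 0 = 0 := fun x hx => by
    rw [← G2.mat_inv_mulVec_dotProduct g, Matrix.mulVec_mulVec, G2.mat_inv, G2.transpose_mul,
      Matrix.one_mulVec, single_one_dotProduct] at hx
    rw [G2.mat_inv, hx]
  rw [← G2.mat_inv_mulVec_dotProduct g, G2.mulVec_cross,
    cross_dotProduct_of_apply_zero (h0 u hu) (h0 v hv) (h0 w hw)]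
  rfl

/-- The complex linear part of a real linear endomorphism of `ℂ³`. -/
def linearPart (L : (Fin 3 → ℂ) →ₗ[ℝ] (Fin 3 → ℂ)) : Matrix (Fin 3) (Fin 3) ℂ :=
  Matrix.of fun k j => (L (Pi.single j 1) k - Complex.I * L (Pi.single j Complex.I) k) / 2

/-- The complex antilinear part of a real linear endomorphism of `ℂ³`. -/
def antilinearPart (L : (Fin 3 → ℂ) →ₗ[ℝ] (Fin 3 → ℂ)) : Matrix (Fin 3) (Fin 3) ℂ :=
  Matrix.of fun k j => (L (Pi.single j 1) k + Complex.I * L (Pi.single j Complex.I) k) / 2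

theorem linearPart_add_antilinearPart (L : (Fin 3 → ℂ) →ₗ[ℝ] (Fin 3 → ℂ)) (v : Fin 3 → ℂ) :
    linearPart L *ᵥ v + antilinearPart L *ᵥ star v = L v := by
  have hv : v = ∑ j, ((v j).re • (Pi.single j 1 : Fin 3 → ℂ) +
      (v j).im • (Pi.single j Complex.I : Fin 3 → ℂ)) := by
    ext k
    fin_cases k <;> simp [Fin.sum_univ_three, Complex.re_add_im]
  conv_rhs => rw [hv]
  ext k
  simp only [map_sum, map_add, map_smul, Finset.sum_apply, Pi.add_apply, Pi.smul_apply,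
    Matrix.mulVec, dotProduct, linearPart, antilinearPart, Matrix.of_apply, Pi.star_apply,
    ← Finset.sum_add_distrib]
  refine Finset.sum_congr rfl fun j _ => ?_
  have h1 := Complex.re_add_im (v j)
  have h2 : star (v j) = (v j).re - (v j).im * Complex.I := by
    apply Complex.ext <;> simp
  rw [h2, Complex.real_smul, Complex.real_smul]
  nth_rewrite 1 [← h1]
  linear_combination (-((v j).im : ℂ) * L (Pi.single j Complex.I) k) * Complex.I_sq

/-- A decomposition into complex linear and antilinear parts is unique. -/
theorem eq_of_mulVec_add_mulVec_star {r s r' s' : Matrix (Fin 3) (Fin 3) ℂ}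
    (h : ∀ v : Fin 3 → ℂ, r' *ᵥ v + s' *ᵥ star v = r *ᵥ v + s *ᵥ star v) : r' = r ∧ s' = s := by
  have h1 : ∀ k j, r' k j + s' k j = r k j + s k j := fun k j => by
    simpa [Pi.star_single] using congrFun (h (Pi.single j 1)) k
  have h2 : ∀ k j, r' k j * Complex.I - s' k j * Complex.I =
      r k j * Complex.I - s k j * Complex.I := fun k j => by
    simpa [Pi.star_single, sub_eq_add_neg, mul_comm] using congrFun (h (Pi.single j Complex.I)) k
  have h3 : ∀ k j, r' k j - s' k j = r k j - s k j := fun k j =>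
    mul_right_cancel₀ Complex.I_ne_zero (by rw [sub_mul, sub_mul, h2])
  constructor <;> ext k j
  · linear_combination (h1 k j + h3 k j) / 2
  · linear_combination (h1 k j - h3 k j) / 2

theorem det_add_sub_det_smul_sub (p q : Matrix (Fin 3) (Fin 3) ℂ) :
    (Matrix.of ![p 0 + q 0, p 1 + q 1, p 2 + q 2]).det -
      ((Matrix.of ![Complex.I • (p 0 - q 0), Complex.I • (p 1 - q 1), p 2 + q 2]).det +
      (Matrix.of ![p 0 + q 0, Complex.I • (p 1 - q 1), Complex.I • (p 2 - q 2)]).det +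
      (Matrix.of ![Complex.I • (p 0 - q 0), p 1 + q 1, Complex.I • (p 2 - q 2)]).det) =
    4 * (p.det + q.det) := by
  simp only [Matrix.det_fin_three]
  simp
  ring_nf
  simp only [Complex.I_sq]
  ring

/-- If the imaginary part of the pullback of the complex volume form by a real linear map has no
`(3,0)`-part, then the determinants of the complex linear and the antilinear part are conjugate. -/
theorem det_map_star_antilinearPart {L : (Fin 3 → ℂ) →ₗ[ℝ] (Fin 3 → ℂ)}
    (h : ∀ a b c : Fin 3 → ℂ, (Matrix.of ![L a, L b, L c]).det.im =
      (Matrix.of ![L (Complex.I • a), L (Complex.I • b), L c]).det.im +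
      (Matrix.of ![L a, L (Complex.I • b), L (Complex.I • c)]).det.im +
      (Matrix.of ![L (Complex.I • a), L b, L (Complex.I • c)]).det.im) :
    ((antilinearPart L).map star).det = (linearPart L).det := by
  have hd : ((antilinearPart L).map star).det = star (antilinearPart L).det :=
    ((starRingEnd ℂ).map_det (antilinearPart L)).symm
  have hL : ∀ v, L v = linearPart L *ᵥ v + antilinearPart L *ᵥ star v := fun v =>
    (linearPart_add_antilinearPart L v).symm
  have hc : ∀ (j : Fin 3) (c : ℂ), L (Pi.single j c) =
      c • (linearPart L)ᵀ j + star c • (antilinearPart L)ᵀ j := fun j c => by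
    rw [hL]
    ext k
    simp [Pi.star_single]
  have h1 := h (Pi.single 0 1) (Pi.single 1 1) (Pi.single 2 1)
  have h2 := h (Pi.single 0 Complex.I) (Pi.single 1 1) (Pi.single 2 1)
  have e1 := det_add_sub_det_smul_sub (linearPart L)ᵀ (antilinearPart L)ᵀ
  have e2 := det_add_sub_det_smul_sub
    ((linearPart L)ᵀ.updateRow 0 (Complex.I • (linearPart L)ᵀ 0))
    ((antilinearPart L)ᵀ.updateRow 0 (-Complex.I • (antilinearPart L)ᵀ 0))
  rw [Matrix.det_updateRow_smul, Matrix.det_updateRow_smul, Matrix.updateRow_eq_self,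
    Matrix.updateRow_eq_self] at e2
  rw [Matrix.det_transpose, Matrix.det_transpose] at e1 e2
  have e1' := congrArg Complex.im e1
  have e2' := congrArg Complex.im e2
  simp [Matrix.updateRow_ne, smul_add, ← Pi.single_smul, hc, sub_eq_add_neg, smul_smul]
    at h1 h2 e1' e2'
  rw [hd]
  refine Complex.ext ?_ ?_
  · simp
    linarith
  · simp
    linarith

/-! ### The geometry of the sphere -/

instance finrank_E7_fact : Fact (Module.finrank ℝ E7 = 6 + 1) := ⟨by simp⟩

theorem tangentIncl_injective (y : S6) : Function.Injective (tangentIncl y) :=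
  injective_mvfderiv_subtypeVal_sphere y

theorem range_tangentIncl (y : S6) :
    (tangentIncl y : TS6 y →ₗ[ℝ] E7).range = (ℝ ∙ (y : E7))ᗮ :=
  range_mvfderiv_subtypeVal y

theorem dotProduct_tangentIncl (y : S6) (v : TS6 y) :
    WithLp.ofLp (y : E7) ⬝ᵥ WithLp.ofLp (tangentIncl y v) = 0 := by
  have h : tangentIncl y v ∈ (ℝ ∙ (y : E7))ᗮ := by
    rw [← range_tangentIncl]; exact ⟨v, rfl⟩
  rw [Submodule.mem_orthogonal_singleton_iff_inner_left] at h
  rw [← h, EuclideanSpace.inner_eq_star_dotProduct]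
  rfl

/-- The velocity in `ℝ⁷` of a curve in the sphere. -/
theorem hasDerivAt_coe_sphere {p : ℝ → S6} {t : ℝ} (hp : MDifferentiableAt 𝓘(ℝ, ℝ) (𝓡 6) p t) :
    HasDerivAt (fun s => (p s : E7))
      (tangentIncl (p t) (mfderiv 𝓘(ℝ, ℝ) (𝓡 6) p t (1 : ℝ))) t := by
  have h1 : MDifferentiableAt (𝓡 6) 𝓘(ℝ, E7) (fun z : S6 => (z : E7)) (p t) :=
    (contMDiff_coe_sphere (p t)).mdifferentiableAt one_ne_zero
  have h : HasFDerivAt (fun s => (p s : E7)) ((tangentIncl (p t) : E6 →L[ℝ] E7).comp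
      (mfderiv 𝓘(ℝ, ℝ) (𝓡 6) p t : ℝ →L[ℝ] E6)) t :=
    hasMFDerivAt_iff_hasFDerivAt.1 (h1.hasMFDerivAt.comp t hp.hasMFDerivAt)
  exact h.hasDerivAt

theorem orbit_coe (g : G2) : WithLp.ofLp (orbit g : E7) = G2.mat g *ᵥ Pi.single 0 1 := rfl

theorem ofLp_mfderiv_orbit {p : ℝ → S6} {g : ℝ → G2} {t : ℝ} (h : ∀ s, orbit (g s) = p s)
    (hp : MDifferentiableAt 𝓘(ℝ, ℝ) (𝓡 6) p t) :
    WithLp.ofLp (tangentIncl (p t) (mfderiv 𝓘(ℝ, ℝ) (𝓡 6) p t (1 : ℝ))) =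
      (Matrix.of fun i j => deriv (fun s => G2.mat (g s) i j) t) *ᵥ Pi.single 0 1 := by
  ext i
  have h1 := (hasDerivAt_pi.1 ((PiLp.continuousLinearEquiv 2 ℝ
    (fun _ : Fin 7 => ℝ)).hasFDerivAt.comp_hasDerivAt t
    (hasDerivAt_coe_sphere hp))) i
  have h2 : (fun s => (p s : E7) i) = fun s => G2.mat (g s) i 0 := by
    funext s
    rw [← h, orbit_coe]
    simp
  have h3 := h1.deriv
  simp only [Function.comp_apply, PiLp.coe_continuousLinearEquiv] at h3
  rw [h2] at h3
  refine h3.symm.trans ?_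
  simp

theorem thetaVelocity_eq {J : AlmostComplexStructure} {γ : ℝ → FibreProduct J}
    (hγ : SmoothAtZero γ) :
    thetaVelocity γ = thetaAt (γ 0).g (WithLp.ofLp (tangentIncl (γ 0).u.1.1
      (mfderiv 𝓘(ℝ, ℝ) (𝓡 6) (fun t => (γ t).u.1.1) 0 (1 : ℝ)))) := by
  rw [thetaVelocity, theta_eq_thetaAt]
  congr 1
  symm
  refine ofLp_mfderiv_orbit (p := fun t => (γ t).u.1.1) (fun s => (γ s).base_eq) ?_
  exact ((contMDiffAt_hom_bundle _).1 hγ.2).1.mdifferentiableAt (by simp)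

/-- A frame as a linear equivalence. -/
def FibreProduct.frame {J : AlmostComplexStructure} (b : FibreProduct J) :
    TS6 b.u.1.1 ≃ₗ[ℝ] (Fin 3 → ℂ) :=
  LinearEquiv.ofBijective (M₂ := Fin 3 → ℂ) (b.u.1.2 : TS6 b.u.1.1 →ₗ[ℝ] (Fin 3 → ℂ)) b.u.2.1

theorem FibreProduct.frame_toFun {J : AlmostComplexStructure} (b : FibreProduct J)
    (v : TS6 b.u.1.1) : b.frame (J.toFun b.u.1.1 v) = Complex.I • b.frame v := b.u.2.2 v

theorem FibreProduct.toFun_frame_symm {J : AlmostComplexStructure} (b : FibreProduct J)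
    (v : Fin 3 → ℂ) : J.toFun b.u.1.1 (b.frame.symm v) = b.frame.symm (Complex.I • v) := by
  rw [LinearEquiv.eq_symm_apply, b.frame_toFun, LinearEquiv.apply_symm_apply]

/-- The form `θ` as a function of `η`. -/
def FibreProduct.thetaOfEta {J : AlmostComplexStructure} (b : FibreProduct J) :
    (Fin 3 → ℂ) →ₗ[ℝ] (Fin 3 → ℂ) :=
  thetaAt b.g ∘ₗ (WithLp.linearEquiv 2 ℝ (Fin 7 → ℝ)).toLinearMap ∘ₗ
    (tangentIncl b.u.1.1 : TS6 b.u.1.1 →ₗ[ℝ] E7) ∘ₗ b.frame.symm.toLinearMap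

theorem FibreProduct.thetaOfEta_frame {J : AlmostComplexStructure} (b : FibreProduct J)
    (v : TS6 b.u.1.1) :
    b.thetaOfEta (b.frame v) = thetaAt b.g (WithLp.ofLp (tangentIncl b.u.1.1 v)) := by
  simp [FibreProduct.thetaOfEta]

theorem thetaVelocity_eq_thetaOfEta {J : AlmostComplexStructure} {γ : ℝ → FibreProduct J}
    (hγ : SmoothAtZero γ) : thetaVelocity γ = (γ 0).thetaOfEta (etaVelocity γ) := by
  rw [thetaVelocity_eq hγ, ← FibreProduct.thetaOfEta_frame]
  rfl

/-! ### The exterior derivative of the standard two-form -/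

theorem cross_dotProduct_swap (u v w : Fin 7 → ℝ) : cross u v ⬝ᵥ w = -(cross u w ⬝ᵥ v) := by
  simp [cross, dotProduct, Fin.sum_univ_succ]
  ring

theorem cross_dotProduct_rotate (u v w : Fin 7 → ℝ) : cross u v ⬝ᵥ w = cross v w ⬝ᵥ u := by
  simp [cross, dotProduct, Fin.sum_univ_succ]
  ring

theorem HasDerivAt.cross_dotProduct {f g h : ℝ → Fin 7 → ℝ} {f' g' h' : Fin 7 → ℝ} {t : ℝ}
    (hf : HasDerivAt f f' t) (hg : HasDerivAt g g' t) (hh : HasDerivAt h h' t) :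
    HasDerivAt (fun s => cross (f s) (g s) ⬝ᵥ h s)
      (cross f' (g t) ⬝ᵥ h t + cross (f t) g' ⬝ᵥ h t + cross (f t) (g t) ⬝ᵥ h') t := by
  have h1 : HasDerivAt (fun s => cross (f s) (g s)) (cross (f t) g' + cross f' (g t)) t :=
    crossBilin.hasDerivAt_of_bilinear (fun _ => hf) (fun _ => hg)
  have h2 := HasDerivAt.fun_sum (u := Finset.univ) fun i _ =>
    (hasDerivAt_pi.1 h1 i).mul (hasDerivAt_pi.1 hh i)
  convert! h2 using 1
  simp only [dotProduct, ← Finset.sum_add_distrib, Pi.add_apply]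
  refine Finset.sum_congr rfl fun i _ => ?_
  ring

theorem omega_eq (y : S6) (u v : TS6 y) :
    omega y u v = cross (WithLp.ofLp (y : E7)) (WithLp.ofLp (tangentIncl y u)) ⬝ᵥ
      WithLp.ofLp (tangentIncl y v) := by
  rw [omega, EuclideanSpace.inner_eq_star_dotProduct, octonionicJ, dotProduct_comm]
  rfl

/-- The antisymmetrization of a family of two-forms of type `(1,1)` has no `(3,0)`-part. -/
theorem cyclic_sum_eq {V : Type*} [AddCommGroup V] [Module ℂ V] {T P : V → V → V → ℝ}
    (h1 : ∀ c a b, P c (Complex.I • a) (Complex.I • b) = P c a b)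
    (h2 : ∀ c a b, P c (Complex.I • a) b = -P c a (Complex.I • b))
    (hT : ∀ a b c, 3 * T a b c = P a b c + P b c a + P c a b) (a b c : V) :
    T a b c = T (Complex.I • a) (Complex.I • b) c + T a (Complex.I • b) (Complex.I • c) +
      T (Complex.I • a) b (Complex.I • c) := by
  have e0 := hT a b c
  have e1 := hT (Complex.I • a) (Complex.I • b) c
  have e2 := hT a (Complex.I • b) (Complex.I • c)
  have e3 := hT (Complex.I • a) b (Complex.I • c)
  rw [h1, h2 (Complex.I • a)] at e1
  rw [h1, h2 (Complex.I • b)] at e2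
  rw [h1, h2 (Complex.I • c)] at e3
  linarith

/-- If the pullback of the standard two-form by `F` is of type `(1,1)`, then the pullback of the
octonionic three-form has no `(3,0)`-part. -/
theorem cross_fderiv_dotProduct {V : Type*} [NormedAddCommGroup V] [NormedSpace ℝ V]
    [NormedSpace ℂ V] {F : V → Fin 7 → ℝ} {U : Set V} (hU : IsOpen U)
    (hF : ContDiffOn ℝ ∞ F U)
    (h : ∀ z ∈ U, ∀ a b, cross (F z) (fderiv ℝ F z (Complex.I • a)) ⬝ᵥ
      fderiv ℝ F z (Complex.I • b) = cross (F z) (fderiv ℝ F z a) ⬝ᵥ fderiv ℝ F z b)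
    {z : V} (hz : z ∈ U) (a b c : V) :
    cross (fderiv ℝ F z a) (fderiv ℝ F z b) ⬝ᵥ fderiv ℝ F z c =
      cross (fderiv ℝ F z (Complex.I • a)) (fderiv ℝ F z (Complex.I • b)) ⬝ᵥ fderiv ℝ F z c +
      cross (fderiv ℝ F z a) (fderiv ℝ F z (Complex.I • b)) ⬝ᵥ fderiv ℝ F z (Complex.I • c) +
      cross (fderiv ℝ F z (Complex.I • a)) (fderiv ℝ F z b) ⬝ᵥ fderiv ℝ F z (Complex.I • c) := by
  have hFz : ContDiffAt ℝ ∞ F z := hF.contDiffAt (hU.mem_nhds hz)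
  have hD : DifferentiableAt ℝ (fderiv ℝ F) z :=
    (hFz.fderiv_right (m := 1) (by norm_num; exact ENat.LEInfty.out)).differentiableAt (by simp)
  have hsymm : ∀ a b, fderiv ℝ (fderiv ℝ F) z a b = fderiv ℝ (fderiv ℝ F) z b a := fun a b =>
    (hFz.isSymmSndFDerivAt (by simpa using ENat.LEInfty.out)) a b
  have hline : ∀ c : V, HasDerivAt (fun t : ℝ => z + t • c) c 0 := fun c => by
    simpa using ((hasDerivAt_id (0 : ℝ)).smul_const c).const_add z
  have hline0 : ∀ c : V, z + (0 : ℝ) • c = z := fun c => by simp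
  have hd : ∀ c : V, HasDerivAt (fun t : ℝ => F (z + t • c)) (fderiv ℝ F z c) 0 := fun c =>
    HasFDerivAt.comp_hasDerivAt (0 : ℝ)
      (by rw [hline0]; exact (hFz.differentiableAt (by simp)).hasFDerivAt) (hline c)
  have hdd : ∀ c a : V, HasDerivAt (fun t : ℝ => fderiv ℝ F (z + t • c) a)
      (fderiv ℝ (fderiv ℝ F) z c a) 0 := fun c a => by
    have h1 : HasDerivAt (fun t : ℝ => fderiv ℝ F (z + t • c)) (fderiv ℝ (fderiv ℝ F) z c) 0 :=
      HasFDerivAt.comp_hasDerivAt (0 : ℝ) (by rw [hline0]; exact hD.hasFDerivAt) (hline c)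
    have h2 := h1.clm_apply (hasDerivAt_const 0 a)
    rwa [map_zero, add_zero] at h2
  let P : V → V → V → ℝ := fun c a b =>
    cross (fderiv ℝ F z c) (fderiv ℝ F z a) ⬝ᵥ fderiv ℝ F z b +
    cross (F z) (fderiv ℝ (fderiv ℝ F) z c a) ⬝ᵥ fderiv ℝ F z b +
    cross (F z) (fderiv ℝ F z a) ⬝ᵥ fderiv ℝ (fderiv ℝ F) z c b
  have hP : ∀ c a b : V, HasDerivAt (fun t : ℝ => cross (F (z + t • c))
      (fderiv ℝ F (z + t • c) a) ⬝ᵥ fderiv ℝ F (z + t • c) b) (P c a b) 0 := fun c a b => by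
    simpa only [hline0] using (hd c).cross_dotProduct (hdd c a) (hdd c b)
  have hmem : ∀ c : V, ∀ᶠ t : ℝ in nhds 0, z + t • c ∈ U := fun c =>
    (hline c).continuousAt.eventually_mem (by rw [hline0]; exact hU.mem_nhds hz)
  have h1 : ∀ c a b, P c (Complex.I • a) (Complex.I • b) = P c a b := fun c a b =>
    ((hP c (Complex.I • a) (Complex.I • b)).congr_of_eventuallyEq
      ((hmem c).mono fun t ht => (h _ ht a b).symm)).unique (hP c a b) |>.symm ▸ rfl
  have hII : ∀ b : V, Complex.I • Complex.I • b = -b := fun b => by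
    rw [smul_smul, Complex.I_mul_I, neg_one_smul]
  have h2 : ∀ c a b, P c (Complex.I • a) b = -P c a (Complex.I • b) := fun c a b => by
    rw [← h1 c a, hII]
    simp only [P, map_neg, dotProduct_neg]
    ring
  have hT : ∀ a b c, 3 * (cross (fderiv ℝ F z a) (fderiv ℝ F z b) ⬝ᵥ fderiv ℝ F z c) =
      P a b c + P b c a + P c a b := fun a b c => by
    simp only [P]
    rw [hsymm b a, hsymm c b, hsymm c a,
      cross_dotProduct_swap _ (fderiv ℝ F z b) (fderiv ℝ (fderiv ℝ F) z a c),
      cross_dotProduct_swap _ (fderiv ℝ F z c) (fderiv ℝ (fderiv ℝ F) z a b),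
      cross_dotProduct_swap _ (fderiv ℝ F z a) (fderiv ℝ (fderiv ℝ F) z b c),
      ← cross_dotProduct_rotate (fderiv ℝ F z a) (fderiv ℝ F z b),
      cross_dotProduct_rotate (fderiv ℝ F z c) (fderiv ℝ F z a)]
    ring
  exact cyclic_sum_eq (T := fun a b c =>
    cross (fderiv ℝ F z a) (fderiv ℝ F z b) ⬝ᵥ fderiv ℝ F z c) h1 h2 hT a b c

/-- For an integrable `ω`-compatible `J`, the differential of the standard two-form has no
`(3,0)`-part. -/
theorem AlmostComplexStructure.Integrable.cross_dotProduct {J : AlmostComplexStructure}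
    (hJ : J.Integrable) (hω : J.OmegaCompatible) (y : S6) {u v w u' v' w' : TS6 y}
    (hu : J.toFun y u = u') (hv : J.toFun y v = v') (hw : J.toFun y w = w') :
    cross (WithLp.ofLp (tangentIncl y u)) (WithLp.ofLp (tangentIncl y v)) ⬝ᵥ
        WithLp.ofLp (tangentIncl y w) =
      cross (WithLp.ofLp (tangentIncl y u')) (WithLp.ofLp (tangentIncl y v')) ⬝ᵥ
        WithLp.ofLp (tangentIncl y w) +
      cross (WithLp.ofLp (tangentIncl y u)) (WithLp.ofLp (tangentIncl y v')) ⬝ᵥ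
        WithLp.ofLp (tangentIncl y w') +
      cross (WithLp.ofLp (tangentIncl y u')) (WithLp.ofLp (tangentIncl y v)) ⬝ᵥ
        WithLp.ofLp (tangentIncl y w') := by
  subst hu hv hw
  obtain ⟨φ, hy, hφ, hφ', hJφ⟩ := hJ y
  have hm : φ.MDifferentiable (𝓡 6) 𝓘(ℝ, Fin 3 → ℂ) :=
    ⟨hφ.mdifferentiableOn (by simp), hφ'.mdifferentiableOn (by simp)⟩
  let F : (Fin 3 → ℂ) → Fin 7 → ℝ := fun z => WithLp.ofLp (φ.symm z : E7)
  have hFs : ContDiffOn ℝ ∞ F φ.target := by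
    have h1 : ContMDiffOn 𝓘(ℝ, Fin 3 → ℂ) 𝓘(ℝ, E7) ∞ (fun z => (φ.symm z : E7)) φ.target :=
      contMDiff_coe_sphere.comp_contMDiffOn hφ'
    exact (PiLp.continuousLinearEquiv 2 ℝ (fun _ : Fin 7 => ℝ)).contDiff.comp_contDiffOn
      (contMDiffOn_iff_contDiffOn.1 h1)
  have hFd : ∀ x ∈ φ.source, ∀ t : TS6 x,
      fderiv ℝ F (φ x) (AlmostComplexStructure.complexDiff φ x t) =
        WithLp.ofLp (tangentIncl x t) := by
    intro x hx t
    have h1 : MDifferentiableAt (𝓡 6) 𝓘(ℝ, Fin 3 → ℂ) φ x := hm.mdifferentiableAt hx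
    have h2 : HasFDerivAt F (fderiv ℝ F (φ x)) (φ x) :=
      ((hFs.contDiffAt (φ.open_target.mem_nhds (φ.map_source hx))).differentiableAt
        (by simp)).hasFDerivAt
    have h3 := h2.hasMFDerivAt.comp x h1.hasMFDerivAt
    have h4 : HasMFDerivAt (𝓡 6) 𝓘(ℝ, E7) (fun z : S6 => (z : E7)) x (tangentIncl x) :=
      ((contMDiff_coe_sphere x).mdifferentiableAt one_ne_zero).hasMFDerivAt
    have h5 := ((PiLp.continuousLinearEquiv 2 ℝ
      (fun _ : Fin 7 => ℝ)).hasFDerivAt (x := (x : E7))).hasMFDerivAt.comp x h4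
    have h6 := h5.congr_of_eventuallyEq (f₁ := F ∘ φ)
      (Filter.eventuallyEq_of_mem (φ.open_source.mem_nhds hx) fun x' hx' => by
        simp only [F, Function.comp_apply, φ.left_inv hx']
        rfl)
    exact congrArg (fun A => A t) (hasMFDerivAt_unique h3 h6)
  have hsurj : ∀ x ∈ φ.source, ∀ a : Fin 3 → ℂ, ∃ t : TS6 x,
      AlmostComplexStructure.complexDiff φ x t = a := fun x hx a => (hm.mfderiv_bijective hx).2 a
  have key := cross_fderiv_dotProduct φ.open_target hFs (fun z hz a b => by
    obtain ⟨x, hx, rfl⟩ : ∃ x ∈ φ.source, φ x = z :=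
      ⟨φ.symm z, φ.map_target hz, φ.right_inv hz⟩
    obtain ⟨s, rfl⟩ := hsurj x hx a
    obtain ⟨t, rfl⟩ := hsurj x hx b
    rw [← hJφ x hx, ← hJφ x hx, hFd x hx, hFd x hx, hFd x hx, hFd x hx]
    have := hω x s t
    rw [omega_eq, omega_eq] at this
    simpa [F, φ.left_inv hx] using this.symm) (φ.map_source hy)
    (AlmostComplexStructure.complexDiff φ y u) (AlmostComplexStructure.complexDiff φ y v)
    (AlmostComplexStructure.complexDiff φ y w)
  simpa only [← hJφ y hy, hFd y hy] using key

theorem FibreProduct.thetaOfEta_apply {J : AlmostComplexStructure} (b : FibreProduct J)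
    (a : Fin 3 → ℂ) :
    b.thetaOfEta a = thetaAt b.g (WithLp.ofLp (tangentIncl b.u.1.1 (b.frame.symm a))) := rfl

/-- Chern's identity. -/
theorem FibreProduct.det_antilinearPart {J : AlmostComplexStructure} (hJ : J.Integrable)
    (hω : J.OmegaCompatible) (b : FibreProduct J) :
    ((antilinearPart b.thetaOfEta).map star).det = (linearPart b.thetaOfEta).det := by
  refine det_map_star_antilinearPart fun a₁ a₂ a₃ => ?_
  have h0 : ∀ v : TS6 b.u.1.1, (G2.mat b.g *ᵥ Pi.single 0 1) ⬝ᵥ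
      WithLp.ofLp (tangentIncl b.u.1.1 v) = 0 := fun v => by
    have h := dotProduct_tangentIncl b.u.1.1 v
    rwa [← b.base_eq, orbit_coe, b.base_eq] at h
  have hc : ∀ a₁ a₂ a₃ : Fin 3 → ℂ,
      cross (WithLp.ofLp (tangentIncl b.u.1.1 (b.frame.symm a₁)))
        (WithLp.ofLp (tangentIncl b.u.1.1 (b.frame.symm a₂))) ⬝ᵥ
        WithLp.ofLp (tangentIncl b.u.1.1 (b.frame.symm a₃)) =
      -8 * (Matrix.of ![b.thetaOfEta a₁, b.thetaOfEta a₂, b.thetaOfEta a₃]).det.im :=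
    fun a₁ a₂ a₃ =>
      _root_.cross_dotProduct b.g (b.thetaOfEta_apply a₁).symm (b.thetaOfEta_apply a₂).symm
        (b.thetaOfEta_apply a₃).symm (h0 _) (h0 _) (h0 _)
  have h := hJ.cross_dotProduct hω b.u.1.1 (b.toFun_frame_symm a₁) (b.toFun_frame_symm a₂)
    (b.toFun_frame_symm a₃)
  refine mul_left_cancel₀ (by norm_num : (-8 : ℝ) ≠ 0) ?_
  rw [mul_add, mul_add]
  exact (hc _ _ _).symm.trans (h.trans (congrArg₂ (· + ·)
    (congrArg₂ (· + ·) (hc _ _ _) (hc _ _ _)) (hc _ _ _)))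

/-! ### Curves in the fibre product -/

/-- The element of `𝔤₂` with `D = 0`. -/
def g2Mat (a : Fin 3 → ℂ) : Matrix (Fin 7) (Fin 7) ℝ :=
  let x : Fin 3 → ℝ := fun k => (a k).re
  let y : Fin 3 → ℝ := fun k => (a k).im
  !![0, -2 * y 0, 2 * x 0, -2 * y 1, 2 * x 1, -2 * y 2, 2 * x 2;
    2 * y 0, 0, 0, x 2, -y 2, -x 1, y 1;
    -2 * x 0, 0, 0, -y 2, -x 2, y 1, x 1;
    2 * y 1, -x 2, y 2, 0, 0, x 0, -y 0;
    -2 * x 1, y 2, x 2, 0, 0, -y 0, -x 0;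
    2 * y 2, x 1, -y 1, -x 0, y 0, 0, 0;
    -2 * x 2, -y 1, -x 1, y 0, x 0, 0, 0]

theorem transpose_g2Mat (a : Fin 3 → ℂ) : (g2Mat a)ᵀ = -g2Mat a := by
  ext i j
  fin_cases i <;> fin_cases j <;> simp [g2Mat]

theorem g2Mat_smul (t : ℝ) (a : Fin 3 → ℂ) : g2Mat (t • a) = t • g2Mat a := by
  ext i j
  fin_cases i <;> fin_cases j <;> simp [g2Mat] <;> ring

theorem g2Mat_mem (a : Fin 3 → ℂ) : g2Mat a ∈ g2LieAlgebra := by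
  refine ⟨a, 0, by simp, by simp, ?_⟩
  have h : stdCoframe * (g2Mat a).map Complex.ofReal = g2Block a 0 * stdCoframe := by
    ext (i | k | k) j
    · rw [stdCoframe_mul_apply_zero]
      fin_cases j <;> simp [g2Mat, g2Block, stdCoframe, Matrix.mul_apply,
        Fin.sum_univ_succ, reIdx, imIdx, Complex.ext_iff] <;> ring
    · rw [stdCoframe_mul_apply_left]
      fin_cases k <;> fin_cases j <;> simp [g2Mat, g2Block, stdCoframe, Matrix.mul_apply,
        Fin.sum_univ_succ, reIdx, imIdx, skewMat, Complex.ext_iff]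
    · rw [stdCoframe_mul_apply_right]
      fin_cases k <;> fin_cases j <;> simp [g2Mat, g2Block, stdCoframe, Matrix.mul_apply,
        Fin.sum_univ_succ, reIdx, imIdx, skewMat, Complex.ext_iff]
  rw [inStdFrame, h, Matrix.mul_assoc, stdCoframe_mul_stdFrame, Matrix.mul_one]

theorem exp_mem_specialOrthogonalGroup {n : Type*} [Fintype n] [DecidableEq n] {A : Matrix n n ℝ}
    (hA : Aᵀ = -A) : NormedSpace.exp A ∈ Matrix.specialOrthogonalGroup n ℝ := by
  have horth : ∀ B : Matrix n n ℝ, Bᵀ = -B → (NormedSpace.exp B)ᵀ * NormedSpace.exp B = 1 :=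
    fun B hB => by
      rw [← Matrix.exp_transpose, hB,
        ← Matrix.exp_add_of_commute _ _ (Commute.neg_left (Commute.refl B)), neg_add_cancel,
        NormedSpace.exp_zero]
  refine Matrix.mem_specialOrthogonalGroup_iff.2
    ⟨(Matrix.mem_orthogonalGroup_iff' _ _).2 (horth A hA), ?_⟩
  have h2 : A = (1 / 2 : ℝ) • A + (1 / 2 : ℝ) • A := by
    rw [← add_smul]; norm_num
  have h3 := congrArg Matrix.det (horth ((1 / 2 : ℝ) • A) (by
    rw [Matrix.transpose_smul, hA, smul_neg]))
  rw [Matrix.det_mul, Matrix.det_transpose, Matrix.det_one] at h3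
  rw [h2, Matrix.exp_add_of_commute _ _ (Commute.refl _), Matrix.det_mul, h3]

/-- The exponential of an element of `𝔤₂`. -/
def g2Exp (a : Fin 3 → ℂ) : G2 :=
  ⟨⟨NormedSpace.exp (g2Mat a), exp_mem_specialOrthogonalGroup (transpose_g2Mat a)⟩,
    Subgroup.subset_closure ⟨g2Mat a, g2Mat_mem a, rfl⟩⟩

theorem mat_mul_g2Exp_smul (g : G2) (t : ℝ) (a : Fin 3 → ℂ) :
    G2.mat (g * g2Exp (t • a)) = G2.mat g * NormedSpace.exp (t • g2Mat a) := by
  rw [G2.mat_mul, ← g2Mat_smul]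
  rfl

section

attribute [local instance] Matrix.linftyOpNormedRing Matrix.linftyOpNormedAlgebra

theorem contDiff_exp_smul (B A : Matrix (Fin 7) (Fin 7) ℝ) (i j : Fin 7) :
    ContDiff ℝ ∞ fun t : ℝ => (B * NormedSpace.exp (t • A)) i j := by
  have h1 : ContDiff ℝ ∞ (NormedSpace.exp : Matrix (Fin 7) (Fin 7) ℝ → _) :=
    contDiff_iff_contDiffAt.2 fun x => (NormedSpace.exp_analytic (𝕂 := ℝ) x).contDiffAt
  have h2 : ContDiff ℝ ∞ fun t : ℝ => B * NormedSpace.exp (t • A) :=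
    contDiff_const.mul (h1.comp (contDiff_id.smul contDiff_const))
  exact (LinearMap.toContinuousLinearMap (Matrix.entryLinearMap ℝ ℝ i j)).contDiff.comp h2

theorem hasDerivAt_exp_smul_zero (B A : Matrix (Fin 7) (Fin 7) ℝ) (i j : Fin 7) :
    HasDerivAt (fun t : ℝ => (B * NormedSpace.exp (t • A)) i j) ((B * A) i j) 0 := by
  have h1 := (hasDerivAt_exp_smul_const' A (0 : ℝ)).const_mul B
  rw [zero_smul, NormedSpace.exp_zero, Matrix.mul_one] at h1
  have h2 := (LinearMap.toContinuousLinearMap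
    (Matrix.entryLinearMap ℝ ℝ i j)).hasFDerivAt.comp_hasDerivAt (0 : ℝ) h1
  exact h2

end

theorem contMDiff_orbit {g : ℝ → G2} (hg : ∀ i j, ContDiff ℝ ∞ fun t => G2.mat (g t) i j) :
    ContMDiff 𝓘(ℝ, ℝ) (𝓡 6) ∞ fun t => orbit (g t) := by
  have h : ContDiff ℝ ∞ fun t => (orbit (g t) : E7) := by
    rw [contDiff_euclidean]
    intro i
    simpa [orbit] using hg i 0
  exact h.contMDiff.codRestrict_sphere fun t => (orbit (g t)).2

/-- The image in `ℝ⁷` of the tangent vector at the base point with given value of `η`. -/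
def FibreProduct.embed {J : AlmostComplexStructure} (b : FibreProduct J) (v : Fin 3 → ℂ) :
    Fin 7 → ℝ :=
  WithLp.ofLp (tangentIncl b.u.1.1 (b.frame.symm v))

theorem FibreProduct.embed_injective {J : AlmostComplexStructure} (b : FibreProduct J) :
    Function.Injective b.embed :=
  (WithLp.ofLp_injective 2).comp ((tangentIncl_injective _).comp b.frame.symm.injective)

theorem FibreProduct.dotProduct_embed {J : AlmostComplexStructure} (b : FibreProduct J)
    (v : Fin 3 → ℂ) : (G2.mat b.g *ᵥ Pi.single 0 1) ⬝ᵥ b.embed v = 0 := by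
  have h := dotProduct_tangentIncl b.u.1.1 (b.frame.symm v)
  rwa [← b.base_eq, orbit_coe, b.base_eq] at h

theorem embed_etaVelocity {J : AlmostComplexStructure} {γ : ℝ → FibreProduct J}
    (hγ : SmoothAtZero γ) :
    (γ 0).embed (etaVelocity γ) =
      (Matrix.of fun i j => deriv (fun s => G2.mat (γ s).g i j) 0) *ᵥ Pi.single 0 1 := by
  rw [← ofLp_mfderiv_orbit (p := fun t => (γ t).u.1.1) (fun s => (γ s).base_eq)
    (((contMDiffAt_hom_bundle _).1 hγ.2).1.mdifferentiableAt (by simp))]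
  exact congrArg (fun w => WithLp.ofLp (tangentIncl (γ 0).u.1.1 w))
    ((γ 0).frame.symm_apply_apply (mfderiv 𝓘(ℝ, ℝ) (𝓡 6) (fun t => (γ t).u.1.1) 0 (1 : ℝ)))

theorem exists_g2Mat_mulVec {q : Fin 7 → ℝ} (hq : q 0 = 0) :
    ∃ a, g2Mat a *ᵥ Pi.single 0 1 = q := by
  refine ⟨fun k => ⟨-q (imIdx k) / 2, q (reIdx k) / 2⟩, ?_⟩
  ext i
  fin_cases i <;> simp [g2Mat, reIdx, imIdx, hq] <;> ring

theorem FibreProduct.exists_mul_g2Mat_mulVec {J : AlmostComplexStructure} (b : FibreProduct J)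
    (v : Fin 3 → ℂ) : ∃ a, (G2.mat b.g * g2Mat a) *ᵥ Pi.single 0 1 = b.embed v := by
  have h := b.dotProduct_embed v
  rw [← G2.mat_inv_mulVec_dotProduct b.g, Matrix.mulVec_mulVec, G2.mat_inv, G2.transpose_mul,
    Matrix.one_mulVec, single_one_dotProduct] at h
  obtain ⟨a, ha⟩ := exists_g2Mat_mulVec h
  refine ⟨a, ?_⟩
  rw [← Matrix.mulVec_mulVec, ha, Matrix.mulVec_mulVec, G2.mul_transpose, Matrix.one_mulVec]

section

variable (J : AlmostComplexStructure) (y₀ : S6)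

/-- An almost complex structure in the trivialization of the tangent bundle around `y₀`. -/
def AlmostComplexStructure.inCoord (y : S6) : E6 →L[ℝ] E6 :=
  ContinuousLinearMap.inCoordinates E6 (fun y : S6 => TS6 y) E6 (fun y : S6 => TS6 y) y₀ y y₀ y
    (J.toFun y)

/-- The trivialization of the tangent bundle around `y₀`. -/
def tangentTriv (y : S6) : TS6 y →L[ℝ] E6 :=
  (trivializationAt E6 (fun y : S6 => TS6 y) y₀).continuousLinearMapAt ℝ y

/-- The inverse of the trivialization of the tangent bundle around `y₀`. -/
def tangentTrivSymm (y : S6) : E6 →L[ℝ] TS6 y :=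
  (trivializationAt E6 (fun y : S6 => TS6 y) y₀).symmL ℝ y

/-- The domain of the trivialization of the tangent bundle around `y₀`. -/
def trivBase : Set S6 := (trivializationAt E6 (fun y : S6 => TS6 y) y₀).baseSet

theorem trivBase_mem_nhds : trivBase y₀ ∈ nhds y₀ :=
  (trivializationAt E6 (fun y : S6 => TS6 y) y₀).open_baseSet.mem_nhds
    (FiberBundle.mem_baseSet_trivializationAt' y₀)

variable {y₀}

theorem tangentTrivSymm_tangentTriv {y : S6} (hy : y ∈ trivBase y₀) (v : TS6 y) :
    tangentTrivSymm y₀ y (tangentTriv y₀ y v) = v :=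
  (trivializationAt E6 (fun y : S6 => TS6 y) y₀).symmL_continuousLinearMapAt hy v

theorem tangentTriv_tangentTrivSymm {y : S6} (hy : y ∈ trivBase y₀) (v : E6) :
    tangentTriv y₀ y (tangentTrivSymm y₀ y v) = v :=
  (trivializationAt E6 (fun y : S6 => TS6 y) y₀).continuousLinearMapAt_symmL hy v

theorem AlmostComplexStructure.inCoord_apply (y : S6) (v : E6) :
    J.inCoord y₀ y v = tangentTriv y₀ y (J.toFun y (tangentTrivSymm y₀ y v)) := rfl

theorem AlmostComplexStructure.inCoord_tangentTriv {y : S6} (hy : y ∈ trivBase y₀) (v : TS6 y) :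
    J.inCoord y₀ y (tangentTriv y₀ y v) = tangentTriv y₀ y (J.toFun y v) := by
  rw [J.inCoord_apply, tangentTrivSymm_tangentTriv hy]

theorem AlmostComplexStructure.inCoord_inCoord {y : S6} (hy : y ∈ trivBase y₀) (v : E6) :
    J.inCoord y₀ y (J.inCoord y₀ y v) = -v := by
  rw [J.inCoord_apply y v, J.inCoord_tangentTriv hy, J.sq_eq_neg, map_neg,
    tangentTriv_tangentTrivSymm hy]

variable (u : TS6 y₀ →L[ℝ] (Fin 3 → ℂ))

/-- The complex linear part, at `y`, of the frame that is constant in the trivialization of the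
tangent bundle and equal to `u` at `y₀`, in the trivialization. -/
def frameCoord (y : S6) : E6 →L[ℝ] (Fin 3 → ℂ) :=
  (1 / 2 : ℝ) • ((u : E6 →L[ℝ] (Fin 3 → ℂ)).comp (tangentTrivSymm y₀ y₀ : E6 →L[ℝ] E6) -
    ((LinearMap.toContinuousLinearMap ((Complex.I • LinearMap.id :
      (Fin 3 → ℂ) →ₗ[ℂ] (Fin 3 → ℂ)).restrictScalars ℝ)).comp
      ((u : E6 →L[ℝ] (Fin 3 → ℂ)).comp (tangentTrivSymm y₀ y₀ : E6 →L[ℝ] E6))).comp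
        (J.inCoord y₀ y))

theorem frameCoord_apply (y : S6) (v : E6) : frameCoord J u y v = (1 / 2 : ℝ) •
    (u (tangentTrivSymm y₀ y₀ v) - Complex.I • u (tangentTrivSymm y₀ y₀ (J.inCoord y₀ y v))) := rfl

theorem frameCoord_inCoord {y : S6} (hy : y ∈ trivBase y₀) (v : E6) :
    frameCoord J u y (J.inCoord y₀ y v) = Complex.I • frameCoord J u y v := by
  rw [frameCoord_apply, frameCoord_apply, J.inCoord_inCoord hy, map_neg, map_neg,
    smul_comm Complex.I (1 / 2 : ℝ)]
  congr 1
  rw [smul_sub, smul_neg, smul_smul, Complex.I_mul_I, neg_one_smul, sub_neg_eq_add, sub_neg_eq_add,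
    add_comm]

/-- The complex linear part of the frame that is constant in the trivialization of the tangent
bundle and equal to `u` at `y₀`. -/
def frameExt (y : S6) : TS6 y →L[ℝ] (Fin 3 → ℂ) := (frameCoord J u y).comp (tangentTriv y₀ y)

theorem frameExt_self (hu : ∀ v, u (J.toFun y₀ v) = Complex.I • u v) : frameExt J u y₀ = u := by
  have hy := mem_of_mem_nhds (trivBase_mem_nhds y₀)
  ext1 v
  change frameCoord J u y₀ (tangentTriv y₀ y₀ v) = u v
  rw [frameCoord_apply, J.inCoord_tangentTriv hy, tangentTrivSymm_tangentTriv hy,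
    tangentTrivSymm_tangentTriv hy, hu, smul_smul, Complex.I_mul_I, neg_one_smul, sub_neg_eq_add,
    ← two_smul ℝ, smul_smul]
  norm_num

theorem frameExt_toFun {y : S6} (hy : y ∈ trivBase y₀) (v : TS6 y) :
    frameExt J u y (J.toFun y v) = Complex.I • frameExt J u y v := by
  change frameCoord J u y (tangentTriv y₀ y (J.toFun y v)) = _
  rw [← J.inCoord_tangentTriv hy, frameCoord_inCoord J u hy]
  rfl

theorem contMDiffAt_inCoord {p : ℝ → S6} (hp : ContMDiffAt 𝓘(ℝ, ℝ) (𝓡 6) ∞ p 0) (h0 : p 0 = y₀) :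
    ContDiffAt ℝ ∞ (fun t => J.inCoord y₀ (p t)) 0 := by
  subst h0
  exact ((contMDiffAt_hom_bundle _).1 ((J.smooth (p 0)).comp (0 : ℝ) hp)).2.contDiffAt

theorem contDiffAt_frameCoord {p : ℝ → S6} (hp : ContMDiffAt 𝓘(ℝ, ℝ) (𝓡 6) ∞ p 0)
    (h0 : p 0 = y₀) : ContDiffAt ℝ ∞ (fun t => frameCoord J u (p t)) 0 :=
  (contDiffAt_const.sub
    (contDiffAt_const.clm_comp (contMDiffAt_inCoord J hp h0))).const_smul (1 / 2 : ℝ)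

theorem contMDiffAt_frameExt {p : ℝ → S6} (hp : ContMDiffAt 𝓘(ℝ, ℝ) (𝓡 6) ∞ p 0)
    (h0 : p 0 = y₀) :
    ContMDiffAt 𝓘(ℝ, ℝ) ((𝓡 6).prod 𝓘(ℝ, E6 →L[ℝ] (Fin 3 → ℂ))) ∞
      (fun t => (⟨p t, frameExt J u (p t)⟩ : HomBundle)) 0 := by
  refine (contMDiffAt_hom_bundle _).2 ⟨hp, ?_⟩
  refine ((contDiffAt_frameCoord J u hp h0).congr_of_eventuallyEq ?_).contMDiffAt
  subst h0
  filter_upwards [hp.continuousAt (trivBase_mem_nhds (p 0))] with t ht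
  ext1 v
  have h : ∀ w : Fin 3 → ℂ, (trivializationAt (Fin 3 → ℂ)
      (Bundle.Trivial S6 (Fin 3 → ℂ)) (p 0)).continuousLinearMapAt ℝ (p t) w = w := fun w =>
    congrFun (congrArg DFunLike.coe
      (Bundle.Trivial.continuousLinearMapAt_trivialization ℝ S6 (Fin 3 → ℂ) (p t))) w
  refine (h _).trans ?_
  change frameCoord J u (p t) (tangentTriv (p 0) (p t) (tangentTrivSymm (p 0) (p t) v)) = _
  rw [tangentTriv_tangentTrivSymm ht]

theorem eventually_bijective_frameExt {p : ℝ → S6} (hp : ContMDiffAt 𝓘(ℝ, ℝ) (𝓡 6) ∞ p 0)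
    (h0 : p 0 = y₀) (hb : Function.Bijective u) (hu : ∀ v, u (J.toFun y₀ v) = Complex.I • u v) :
    ∀ᶠ t in nhds (0 : ℝ), Function.Bijective (frameExt J u (p t)) := by
  have hT : ∀ y ∈ trivBase y₀, Function.Bijective (tangentTriv y₀ y) := fun y hy =>
    Function.bijective_iff_has_inverse.2 ⟨tangentTrivSymm y₀ y,
      tangentTrivSymm_tangentTriv hy, tangentTriv_tangentTrivSymm hy⟩
  have hF0 : Function.Bijective (frameCoord J u y₀) := by
    have h : Function.Bijective (frameCoord J u y₀ ∘ tangentTriv y₀ y₀) := by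
      change Function.Bijective (frameExt J u y₀)
      rwa [frameExt_self J u hu]
    exact (Function.Bijective.of_comp_iff _ (hT y₀ (mem_of_mem_nhds (trivBase_mem_nhds y₀)))).1 h
  let e : E6 ≃L[ℝ] (Fin 3 → ℂ) :=
    (LinearEquiv.ofBijective (frameCoord J u y₀ : E6 →ₗ[ℝ] (Fin 3 → ℂ)) hF0).toContinuousLinearEquiv
  have he : frameCoord J u (p 0) = e := by
    rw [h0]
    rfl
  have h1 := (contDiffAt_frameCoord J u hp h0).continuousAt.eventually_mem
    (by rw [he]; exact ContinuousLinearEquiv.nhds e)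
  have h2 : ∀ᶠ t in nhds (0 : ℝ), p t ∈ trivBase y₀ :=
    hp.continuousAt.eventually_mem (by rw [h0]; exact trivBase_mem_nhds y₀)
  filter_upwards [h1, h2] with t ⟨e', he'⟩ ht
  have h3 : Function.Bijective (frameCoord J u (p t)) := by
    rw [← he']
    exact e'.bijective
  exact h3.comp (hT _ ht)

end

/-- A curve in `G₂` lifts to a curve in the fibre product through a given point. -/
theorem FibreProduct.exists_lift {J : AlmostComplexStructure} (b : FibreProduct J) {g : ℝ → G2}
    (hg : ∀ i j, ContDiff ℝ ∞ fun t => G2.mat (g t) i j) (h0 : g 0 = b.g) :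
    ∃ γ : ℝ → FibreProduct J, SmoothAtZero γ ∧ γ 0 = b ∧ ∀ᶠ t in nhds 0, (γ t).g = g t := by
  obtain ⟨g₀, ⟨⟨y, u⟩, hb, hu⟩, hy⟩ := b
  change g 0 = g₀ at h0
  change orbit g₀ = y at hy
  change TS6 y →L[ℝ] (Fin 3 → ℂ) at u
  change Function.Bijective u at hb
  change ∀ v, u (J.toFun y v) = Complex.I • u v at hu
  have hp : ContMDiffAt 𝓘(ℝ, ℝ) (𝓡 6) ∞ (fun t => orbit (g t)) 0 := contMDiff_orbit hg 0
  have hp0 : orbit (g 0) = y := by rw [h0, hy]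
  let U : ℝ → HomBundle := fun t => ⟨orbit (g t), frameExt J u (orbit (g t))⟩
  have hU0 : U 0 = ⟨y, u⟩ := by
    change (⟨orbit (g 0), frameExt J u (orbit (g 0))⟩ : HomBundle) = _
    rw [hp0, frameExt_self J u hu]
  have hgood : ∀ᶠ t in nhds 0, Function.Bijective (U t).2 ∧
      ∀ v : TS6 (U t).1, ((U t).2 (J.toFun (U t).1 v) : Fin 3 → ℂ) =
        Complex.I • ((U t).2 v : Fin 3 → ℂ) := by
    filter_upwards [eventually_bijective_frameExt J u hp hp0 hb hu,
      hp.continuousAt.eventually_mem (show trivBase y ∈ nhds (orbit (g 0)) by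
        rw [hp0]; exact trivBase_mem_nhds y)] with t h1 h2
    exact ⟨h1, frameExt_toFun J u h2⟩
  classical
  let γ : ℝ → FibreProduct J := fun t =>
    if h : Function.Bijective (U t).2 ∧
      ∀ v : TS6 (U t).1, ((U t).2 (J.toFun (U t).1 v) : Fin 3 → ℂ) =
        Complex.I • ((U t).2 v : Fin 3 → ℂ)
    then ⟨g t, ⟨U t, h⟩, rfl⟩ else ⟨g₀, ⟨⟨y, u⟩, hb, hu⟩, hy⟩
  have hγg : ∀ᶠ t in nhds 0, (γ t).g = g t := hgood.mono fun t ht => by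
    simp only [γ, dif_pos ht]
  have hγu : ∀ᶠ t in nhds 0, (γ t).u.1 = U t := hgood.mono fun t ht => by
    simp only [γ, dif_pos ht]
  refine ⟨γ, ⟨fun i j => ?_, ?_⟩, ?_, hγg⟩
  · exact (hg i j).contDiffAt.congr_of_eventuallyEq (hγg.mono fun t ht => by simp only [ht])
  · exact (contMDiffAt_frameExt J u hp hp0).congr_of_eventuallyEq hγu
  · have h1 : (γ 0).g = g₀ := hγg.self_of_nhds.trans h0
    have h2 : (γ 0).u = ⟨⟨y, u⟩, hb, hu⟩ := Subtype.ext (hγu.self_of_nhds.trans hU0)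
    generalize γ 0 = c at h1 h2
    obtain ⟨c₁, c₂, hc⟩ := c
    subst h1 h2
    rfl

/-- Each value of `η` at each point of the fibre product is attained on a velocity. -/
theorem FibreProduct.exists_curve {J : AlmostComplexStructure} (b : FibreProduct J)
    (v : Fin 3 → ℂ) :
    ∃ γ : ℝ → FibreProduct J, SmoothAtZero γ ∧ γ 0 = b ∧ etaVelocity γ = v := by
  obtain ⟨a, ha⟩ := b.exists_mul_g2Mat_mulVec v
  have hg : ∀ t : ℝ, G2.mat (b.g * g2Exp (t • a)) = G2.mat b.g * NormedSpace.exp (t • g2Mat a) :=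
    fun t => mat_mul_g2Exp_smul b.g t a
  obtain ⟨γ, hγ, h0, hγg⟩ := b.exists_lift (g := fun t => b.g * g2Exp (t • a))
    (fun i j => by
      simp only [hg]
      exact contDiff_exp_smul _ _ i j)
    (Subtype.ext (Subtype.ext ((hg 0).trans (by simp; rfl))))
  refine ⟨γ, hγ, h0, ?_⟩
  have h1 := embed_etaVelocity hγ
  have h2 : (Matrix.of fun i j => deriv (fun s => G2.mat (γ s).g i j) 0) =
      G2.mat b.g * g2Mat a := by
    ext i j
    refine ((hasDerivAt_exp_smul_zero _ _ i j).congr_of_eventuallyEq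
      (hγg.mono fun t ht => ?_)).deriv
    simp only [ht, hg]
  rw [h2, ha, h0] at h1
  exact b.embed_injective h1

end

theorem mainTheorem4 (J : AlmostComplexStructure) :
    ∃ r s : FibreProduct J → Matrix (Fin 3) (Fin 3) ℂ,
      ThetaEqEta J r s ∧
      (∀ r' s' : FibreProduct J → Matrix (Fin 3) (Fin 3) ℂ, ThetaEqEta J r' s' → r' = r ∧ s' = s) ∧
      (J.Integrable → J.OmegaCompatible →
        ∀ b : FibreProduct J, ((s b).map star).det = (r b).det) := by
  have hrs : ThetaEqEta J (fun b => linearPart b.thetaOfEta)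
      (fun b => antilinearPart b.thetaOfEta) := fun γ hγ => by
    rw [linearPart_add_antilinearPart, thetaVelocity_eq_thetaOfEta hγ]
  refine ⟨_, _, hrs, fun r' s' h => ?_, fun hJ hω b => b.det_antilinearPart hJ hω⟩
  have huniq : ∀ b : FibreProduct J, r' b = linearPart b.thetaOfEta ∧
      s' b = antilinearPart b.thetaOfEta := fun b => by
    refine eq_of_mulVec_add_mulVec_star fun v => ?_
    obtain ⟨γ, hγ, h0, hv⟩ := b.exists_curve v
    have h1 := (h γ hγ).symm.trans (hrs γ hγ)
    rwa [hv, h0] at h1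
  exact ⟨funext fun b => (huniq b).1, funext fun b => (huniq b).2⟩
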